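/- All graphs are finite and simple. The Laplacian spectrum of a graph $G$ is the multiset of eigenvalues (with multiplicity) of $L(G)=D(G)-A(G)$, where $D(G)$ is the diagonal matrix of vertex degrees and $A(G)$ is the adjacency matrix. A multiset $S$ of $n$ elements of $\{0,1,\dots,n\}$ with $0\in S$ is called Laplacian realizable if there is a connected graph on $n$ vertices whose Laplacian spectrum is $S$. For $0<i<j\le n$ write $$S_{\{i,j\}_n^{m}}=\{0,1,\dots,m-1,m,m,m+1,\dots,n-1,n\}\setminus\{i,j\},$$ where all copies of $i$ and $j$ are removed (so the set has $n$ elements, and can be Laplacian realizable, only if $m\notin\{i,j\}$). Theorem. Let $n\ge 3$. (i) If $n\equiv 0 \pmod 4$, then for $2<j\le n$ the set $S_{\{2,j\}_n^{n-1}}$ is Laplacian realizable if and only if $j=2k+1$ for some $k\in\{1,2,\dots,\frac{n-4}{2}\}$. (ii) If $n\equiv 1 \pmod 4$, then for $2<j<n$ the set $S_{\{2,j\}_n^{n-1}}$ is Laplacian realizable if and only if $j=2k+1$ for some $k\in\{1,2,\dots,\frac{n-3}{2}\}$. (iii) If $n\equiv 2 \pmod 4$, then for $2<j<n$ the set $S_{\{2,j\}_n^{n-1}}$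 is Laplacian realizable if and only if $j=2k+2$ for some $k\in\{1,2,\dots,\frac{n-4}{2}\}$. (iv) If $n\equiv 3 \pmod 4$, then for $2<j\le n$ the set $S_{\{2,j\}_n^{n-1}}$ is Laplacian realizable if and only if $j=2k+2$ for some $k\in\{1,2,\dots,\frac{n-5}{2}\}$. (A range of $k$ whose upper end is less than $1$ is empty.) -/

import Mathlib

/-- The Laplacian spectrum of a finite simple graph: the multiset of the eigenvalues of
its Laplacian matrix `D - A`, repeated according to (algebraic) multiplicity. -/
noncomputable def laplacianSpectrum {V : Type*} [Fintype V] [DecidableEq V]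
    (G : SimpleGraph V) [DecidableRel G.Adj] : Multiset ℝ :=
  (G.lapMatrix ℝ).charpoly.roots

/-- A multiset `S` of natural numbers is Laplacian realizable in order `n` if it consists of
`n` elements (counted with repetition) of `{0, 1, …, n}`, contains `0`, and is the Laplacian
spectrum of some connected simple graph on `n` vertices. -/
def LaplacianRealizable (n : ℕ) (S : Multiset ℕ) : Prop :=
  (∀ x ∈ S, x ≤ n) ∧ Multiset.card S = n ∧ 0 ∈ S ∧
    ∃ (G : SimpleGraph (Fin n)) (_ : DecidableRel G.Adj),
      G.Connected ∧ laplacianSpectrum G = S.map (fun x : ℕ => (x : ℝ))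

/-- `doubleSet i j n m` is the multiset `{0, 1, …, m - 1, m, m, m + 1, …, n} \ {i, j}`:
the numbers `0, 1, …, n` with `m` doubled, from which every copy of `i` and of `j`
is removed. -/
def doubleSet (i j n m : ℕ) : Multiset ℕ :=
  (m ::ₘ Multiset.range (n + 1)).filter (fun x => x ≠ i ∧ x ≠ j)

/-! Necessity is a count plus a parity. If the doubled value is removed, too few elements remain.
Otherwise the trace of the Laplacian is twice the number of edges, so the spectrum has even sum,
which fixes `j` mod 2 and rules out `j = n` when `n` is 0 or 3 mod 4. Sufficiency uses only disjoint
unions, complements, a point and an edge. With one 0 set aside, complementing sends each eigenvalue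
`t` to `n - t` (`HasReducedSpectrum.compl`). Induction gives graphs omitting a single value
(`omitRealizable`). From these come graphs with three zero eigenvalues, and alternating complements
with added isolated vertices turns the extra zeros into the doubled `n - 1` and opens the gaps at 2
and `j`. -/

open Polynomial Matrix

/-- The graph `G` has Laplacian spectrum `{0} + T`, where all members of `T` are at most the
number of vertices. -/
def HasReducedSpectrum {V : Type} [Fintype V] [DecidableEq V] (G : SimpleGraph V)
    [DecidableRel G.Adj] (T : Multiset ℕ) : Prop :=
  (∀ t ∈ T, t ≤ Fintype.card V) ∧
    (G.lapMatrix ℝ).charpoly = X * (T.map fun t : ℕ => X - C (t : ℝ)).prod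

/-- Some graph on `n` vertices has Laplacian spectrum `{0} + T`. -/
def IsReducedSpectrum (n : ℕ) (T : Multiset ℕ) : Prop :=
  ∃ (V : Type) (_ : Fintype V) (_ : DecidableEq V) (G : SimpleGraph V) (_ : DecidableRel G.Adj),
    Fintype.card V = n ∧ HasReducedSpectrum G T

/-! ### Spectra of disjoint unions and complements. -/

noncomputable instance sumAdjDecidable {V W : Type} (G : SimpleGraph V) (H : SimpleGraph W)
    [DecidableRel G.Adj] [DecidableRel H.Adj] : DecidableRel (G ⊕g H).Adj :=
  fun _ _ => Classical.propDecidable _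

section
variable {V W : Type} [Fintype V] [DecidableEq V] [Fintype W] [DecidableEq W]
  (G : SimpleGraph V) (H : SimpleGraph W) [DecidableRel G.Adj] [DecidableRel H.Adj]

theorem lapMatrix_apply (i j : V) :
    G.lapMatrix ℝ i j = (if i = j then (G.degree i : ℝ) else 0) - if G.Adj i j then 1 else 0 := by
  simp [SimpleGraph.lapMatrix, SimpleGraph.degMatrix, Matrix.diagonal_apply]

theorem lapMatrix_sum :
    (G ⊕g H).lapMatrix ℝ = Matrix.fromBlocks (G.lapMatrix ℝ) 0 0 (H.lapMatrix ℝ) := by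
  ext (i | i) (j | j) <;>
    simp [lapMatrix_apply, SimpleGraph.degree_eq_sum_if_adj, -Finset.sum_boole]

theorem HasReducedSpectrum.sum {T U : Multiset ℕ} (hG : HasReducedSpectrum G T)
    (hH : HasReducedSpectrum H U) : HasReducedSpectrum (G ⊕g H) (T + U + {0}) := by
  refine ⟨fun t ht => ?_, ?_⟩
  · simp only [Multiset.mem_add, Multiset.mem_singleton] at ht
    rw [Fintype.card_sum]
    rcases ht with (ht | ht) | rfl
    · exact (hG.1 t ht).trans (by omega)
    · exact (hH.1 t ht).trans (by omega)
    · omega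
  · rw [lapMatrix_sum, Matrix.charpoly_fromBlocks_zero₁₂, hG.2, hH.2]
    simp
    ring

theorem lapMatrix_compl :
    Gᶜ.lapMatrix ℝ = (Fintype.card V : ℝ) • (1 : Matrix V V ℝ)
      - Matrix.vecMulVec 1 1 - G.lapMatrix ℝ := by
  ext i j
  have h : ((Gᶜ.degree i : ℕ) : ℝ) = Fintype.card V - 1 - G.degree i := by
    have := G.degree_lt_card_verts i
    rw [SimpleGraph.degree_compl, Nat.sub_sub, Nat.cast_sub (by omega)]
    push_cast; ring
  simp only [lapMatrix_apply, h, SimpleGraph.compl_adj, Matrix.sub_apply, Matrix.smul_apply,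
    Matrix.one_apply, Matrix.vecMulVec_apply, Pi.one_apply]
  by_cases hij : i = j
  · subst hij; simp
  · by_cases ha : G.Adj i j <;> simp [hij, ha]

theorem lapMatrix_mul_vecMulVec_one : G.lapMatrix ℝ * Matrix.vecMulVec 1 1 = 0 := by
  have : G.lapMatrix ℝ *ᵥ (1 : V → ℝ) = 0 := G.lapMatrix_mulVec_const_eq_zero
  rw [Matrix.mul_vecMulVec, this, Matrix.zero_vecMulVec]

/-- Since `L * J = 0` for the all-ones matrix `J`, `y(yI - J - L) = (yI - L)(yI - J)`; taking
determinants relates the two characteristic polynomials. -/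
theorem eval_charpoly_lapMatrix_compl [Nonempty V] (x : ℝ) (hx : x ≠ Fintype.card V) :
    (Fintype.card V - x) * (Gᶜ.lapMatrix ℝ).charpoly.eval x =
      (-1) ^ Fintype.card V * (-x) * (G.lapMatrix ℝ).charpoly.eval (Fintype.card V - x) := by
  obtain ⟨y, rfl⟩ : ∃ y, x = Fintype.card V - y := ⟨Fintype.card V - x, by ring⟩
  have hy : y ≠ 0 := by rintro rfl; simp at hx
  have hcard : Fintype.card V = Fintype.card V - 1 + 1 := (Nat.succ_pred Fintype.card_ne_zero).symm
  have hmul : y • (Matrix.scalar V y - Matrix.vecMulVec 1 1 - G.lapMatrix ℝ) =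
      (Matrix.scalar V y - G.lapMatrix ℝ) * (Matrix.scalar V y - Matrix.vecMulVec 1 1) := by
    rw [sub_mul, mul_sub (G.lapMatrix ℝ), lapMatrix_mul_vecMulVec_one, mul_sub,
      ← Matrix.scalar_comm _ (Commute.all y) (G.lapMatrix ℝ)]
    simp only [Matrix.scalar_apply, ← Matrix.smul_one_eq_diagonal, smul_sub, Matrix.smul_mul,
      one_mul, sub_zero]
  have hdet := congrArg Matrix.det hmul
  rw [Matrix.det_smul, Matrix.det_mul, ← Matrix.eval_charpoly, ← Matrix.eval_charpoly,
    Matrix.charpoly_vecMulVec] at hdet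
  have hcompl : (Gᶜ.lapMatrix ℝ).charpoly.eval (Fintype.card V - y) = (-1) ^ Fintype.card V *
      (Matrix.scalar V y - Matrix.vecMulVec 1 1 - G.lapMatrix ℝ).det := by
    rw [Matrix.eval_charpoly, lapMatrix_compl, ← Matrix.det_neg]
    congr 1
    simp only [Matrix.scalar_apply, ← Matrix.smul_one_eq_diagonal, sub_smul]
    abel
  have hdot : (1 : V → ℝ) ⬝ᵥ 1 = Fintype.card V := by simp [dotProduct]
  rw [hcompl, sub_sub_cancel]
  refine mul_left_cancel₀ (pow_ne_zero (Fintype.card V - 1) hy) ?_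
  have hpow : y ^ Fintype.card V = y ^ (Fintype.card V - 1) * y := by
    conv_lhs => rw [hcard, pow_succ]
  simp only [hdot, eval_sub, eval_pow, eval_X, eval_smul, smul_eq_mul, hpow] at hdet
  linear_combination (-1) ^ Fintype.card V * hdet

theorem HasReducedSpectrum.card_add_one {T : Multiset ℕ} (hG : HasReducedSpectrum G T) :
    Multiset.card T + 1 = Fintype.card V := by
  have h := natDegree_multiset_prod_X_sub_C_eq_card (T.map fun t : ℕ => (t : ℝ))
  have hmonic := monic_multiset_prod_of_monic T (fun t : ℕ => X - C (t : ℝ))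
    fun t _ => monic_X_sub_C _
  rw [Multiset.map_map, Multiset.card_map] at h
  rw [← (G.lapMatrix ℝ).charpoly_natDegree_eq_dim, hG.2, natDegree_X_mul hmonic.ne_zero]
  exact congrArg (· + 1) h.symm

theorem HasReducedSpectrum.compl {T : Multiset ℕ} (hG : HasReducedSpectrum G T) :
    HasReducedSpectrum Gᶜ (T.map (Fintype.card V - ·)) := by
  refine ⟨fun t ht => ?_, ?_⟩
  · obtain ⟨s, -, rfl⟩ := Multiset.mem_map.1 ht
    exact Nat.sub_le _ _
  have hcard := hG.card_add_one
  have : Nonempty V := Fintype.card_pos_iff.1 (by omega)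
  -- The evaluation identity requires `x` to differ from the order; the remaining infinitely many
  -- points suffice.
  refine eq_of_infinite_eval_eq _ _ (Set.Infinite.mono (s := {(Fintype.card V : ℝ)}ᶜ) ?_
    (Set.finite_singleton _).infinite_compl)
  intro x hx
  have hx' : (Fintype.card V : ℝ) - x ≠ 0 := sub_ne_zero.2 (Ne.symm hx)
  refine mul_left_cancel₀ hx' ?_
  have hprod : (T.map fun t : ℕ => x - ((Fintype.card V - t : ℕ) : ℝ)).prod =
      (-1) ^ Multiset.card T * (T.map fun t : ℕ => (Fintype.card V - x : ℝ) - t).prod := by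
    rw [← Multiset.card_map (fun t : ℕ => (Fintype.card V - x : ℝ) - t) T,
      ← Multiset.prod_map_neg, Multiset.map_map]
    refine congrArg _ (Multiset.map_congr rfl fun t ht => ?_)
    rw [Nat.cast_sub (hG.1 t ht)]
    simp only [Function.comp_apply]; ring
  rw [eval_charpoly_lapMatrix_compl G x hx, hG.2]
  simp only [eval_mul, eval_X, eval_multiset_prod, Multiset.map_map, Function.comp_def, eval_sub,
    eval_C, hprod]
  rw [← hcard, pow_succ]
  ring

theorem lapMatrix_comap (e : W ≃ V) [DecidableRel (G.comap e).Adj] :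
    (G.comap e).lapMatrix ℝ = Matrix.reindex e.symm e.symm (G.lapMatrix ℝ) := by
  ext i j
  simp only [lapMatrix_apply, Matrix.reindex_apply, Matrix.submatrix_apply, Equiv.symm_symm,
    e.injective.eq_iff, SimpleGraph.comap_adj, SimpleGraph.degree_eq_sum_if_adj]
  rw [Equiv.sum_comp e fun k => if G.Adj (e i) k then (1 : ℝ) else 0]

theorem HasReducedSpectrum.comap {T : Multiset ℕ} (hG : HasReducedSpectrum G T) (e : W ≃ V)
    [DecidableRel (G.comap e).Adj] : HasReducedSpectrum (G.comap e) T := by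
  refine ⟨fun t ht => (hG.1 t ht).trans (Fintype.card_congr e).ge, ?_⟩
  rw [lapMatrix_comap, Matrix.charpoly_reindex, hG.2]

theorem HasReducedSpectrum.laplacianSpectrum {T : Multiset ℕ} (hG : HasReducedSpectrum G T) :
    laplacianSpectrum G = ({0} + T).map (fun x : ℕ => (x : ℝ)) := by
  have : X * (T.map fun t : ℕ => X - C (t : ℝ)).prod =
      ((({0} + T).map (fun x : ℕ => (x : ℝ))).map fun a => X - C a).prod := by
    simp [Multiset.map_map]
  rw [_root_.laplacianSpectrum, hG.2, this, roots_multiset_prod_X_sub_C]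

theorem HasReducedSpectrum.laplacianRealizable {T : Multiset ℕ} (hG : HasReducedSpectrum G T)
    (hc : G.Connected) : LaplacianRealizable (Fintype.card V) ({0} + T) := by
  classical
  refine ⟨fun x hx => ?_, ?_, by simp, G.comap (Fintype.equivFin V).symm, inferInstance, ?_, ?_⟩
  · rcases Multiset.mem_add.1 hx with hx | hx
    · simp_all
    · exact hG.1 x hx
  · rw [Multiset.card_add, Multiset.card_singleton, add_comm, hG.card_add_one]
  · exact (SimpleGraph.Iso.comap (Fintype.equivFin V).symm G).connected_iff.2 hc
  · exact (hG.comap G _).laplacianSpectrum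
end

theorem hasReducedSpectrum_unit : HasReducedSpectrum (⊥ : SimpleGraph Unit) 0 := by
  refine ⟨by simp, ?_⟩
  have : (⊥ : SimpleGraph Unit).lapMatrix ℝ = 0 := by ext; simp [lapMatrix_apply]
  simp [this]

namespace IsReducedSpectrum

theorem union {m n : ℕ} {T U : Multiset ℕ} (hT : IsReducedSpectrum m T)
    (hU : IsReducedSpectrum n U) : IsReducedSpectrum (m + n) (T + U + {0}) := by
  obtain ⟨V, _, _, G, _, rfl, hG⟩ := hT
  obtain ⟨W, _, _, H, _, rfl, hH⟩ := hU
  exact ⟨V ⊕ W, inferInstance, inferInstance, G ⊕g H, inferInstance, Fintype.card_sum,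
    hG.sum G H hH⟩

theorem compl {n : ℕ} {T : Multiset ℕ} (hT : IsReducedSpectrum n T) :
    IsReducedSpectrum n (T.map (n - ·)) := by
  obtain ⟨V, _, _, G, _, rfl, hG⟩ := hT
  exact ⟨V, inferInstance, inferInstance, Gᶜ, inferInstance, rfl, hG.compl⟩

theorem one : IsReducedSpectrum 1 0 :=
  ⟨Unit, inferInstance, inferInstance, ⊥, inferInstance, rfl, hasReducedSpectrum_unit⟩

theorem add_vertex {n : ℕ} {T : Multiset ℕ} (hT : IsReducedSpectrum n T) :
    IsReducedSpectrum (n + 1) (T + {0}) := by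
  simpa using hT.union one

theorem two : IsReducedSpectrum 2 {2} := by
  simpa using one.add_vertex.compl

theorem laplacianRealizable_compl {n : ℕ} {T : Multiset ℕ} (hT : IsReducedSpectrum n T) :
    LaplacianRealizable (n + 1) ({0} + (T + {0}).map (n + 1 - ·)) := by
  obtain ⟨V, _, _, G, _, rfl, hG⟩ := hT
  have : Nonempty V := Fintype.card_pos_iff.1 (by have := hG.card_add_one; omega)
  -- The complement of a disconnected graph is connected.
  have h := ((hG.sum G _ hasReducedSpectrum_unit).compl).laplacianRealizable _
    ((SimpleGraph.connected_or_connected_compl _).resolve_left SimpleGraph.not_connected_sum)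
  simpa using h

end IsReducedSpectrum

/-! ### Spectra with prescribed gaps. -/

theorem map_sub_range (n : ℕ) : (Multiset.range (n + 1)).map (n - ·) = Multiset.range (n + 1) := by
  have h : (Finset.range (n + 1)).val.map (n - ·) = (Finset.range (n + 1)).val := by
    have := Finset.image_val_of_injOn (s := Finset.range (n + 1)) (f := (n - ·)) (by
      intro a ha b hb h
      simp only [Finset.coe_range, Set.mem_Iio] at ha hb h
      omega)
    rw [← this]
    congr 1
    ext a
    simp only [Finset.mem_image, Finset.mem_range]
    exact ⟨by rintro ⟨b, -, rfl⟩; omega, fun h => ⟨n - a, by omega, by omega⟩⟩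
  exact h

theorem range_succ_add (n : ℕ) : Multiset.range (n + 1) = Multiset.range n + {n} := by
  rw [Multiset.range_succ, ← Multiset.singleton_add, add_comm]

/-- There is a graph with Laplacian spectrum `{0, 1, …, n} \ {i}`. -/
def OmitRealizable (i n : ℕ) : Prop :=
  ∃ T, {0} + {i} + T = Multiset.range (n + 1) ∧ IsReducedSpectrum n T

theorem OmitRealizable.reflect {i n : ℕ} (hi : i ≤ n + 1) (h : OmitRealizable (n + 1 - i) n) :
    OmitRealizable i (n + 1) := by
  obtain ⟨T, hT, hr⟩ := h
  refine ⟨_, ?_, hr.add_vertex.compl⟩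
  have h1 := congrArg (Multiset.map (n + 1 - ·)) hT
  have h2 := map_sub_range (n + 1)
  rw [range_succ_add, Multiset.map_add, ← h1] at h2
  simp only [Multiset.map_add, Multiset.map_singleton, Nat.sub_zero, Nat.sub_self,
    Nat.sub_sub_self hi] at h2 ⊢
  rw [range_succ_add (n + 1), ← h2]
  abel

/-- A disjoint edge supplies the missing eigenvalue 2 and a second 0; in the complement the two
zeros become 0 and `n + 2`, so only 1 is absent. -/
theorem OmitRealizable.one_of_two {n : ℕ} (h : OmitRealizable 2 n) : OmitRealizable 1 (n + 2) := by
  obtain ⟨T, hT, hr⟩ := h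
  refine ⟨_, ?_, (hr.union .two).compl⟩
  have h1 := congrArg (Multiset.map (n + 2 - ·)) hT
  have h2 := map_sub_range (n + 2)
  rw [range_succ_add, range_succ_add, Multiset.map_add, Multiset.map_add, ← h1] at h2
  simp only [Multiset.map_add, Multiset.map_singleton, Nat.sub_zero, Nat.sub_self,
    show n + 2 - (n + 1) = 1 by omega] at h2 ⊢
  rw [range_succ_add (n + 2), range_succ_add (n + 1), ← h2]
  abel

theorem omitRealizable_one_two : OmitRealizable 1 2 := ⟨{2}, by decide, .two⟩

theorem omitRealizable {i n : ℕ} (hi : 1 ≤ i) (hin : i < n)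
    (hpar : (n * (n + 1) / 2) % 2 = i % 2) : OmitRealizable i n := by
  induction n using Nat.strong_induction_on generalizing i with
  | _ n ih =>
    have htri : ∀ k, (k + 1) * (k + 1 + 1) / 2 = k * (k + 1) / 2 + (k + 1) := fun k => by
      rw [show (k + 1) * (k + 1 + 1) = k * (k + 1) + (k + 1) * 2 by ring,
        Nat.add_mul_div_right _ _ two_pos]
    obtain ⟨m, rfl⟩ : ∃ m, n = m + 2 := ⟨n - 2, by omega⟩
    have h1 := htri (m + 1)
    have h2 := htri m
    rw [show m + 1 + 1 = m + 2 from rfl] at h1 h2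
    rcases hi.eq_or_lt with rfl | hi
    · rcases Nat.eq_zero_or_pos m with rfl | hm
      · exact omitRealizable_one_two
      · have hm2 : 2 < m := by
          by_contra hc
          interval_cases m <;> norm_num at hpar
        exact (ih m (by omega) one_le_two hm2 (by omega)).one_of_two
    · exact (ih (m + 1) (by omega) (by omega) (by omega) (by
        rw [show m + 1 + 1 = m + 2 from rfl]; omega)).reflect (by omega)

/-- For `p ≥ 3` there is a graph on `p` vertices with Laplacian spectrum
`{0, 0, 0, 1, …, p - 2} \ {q}`. -/
theorem exists_three_components {p q : ℕ} (hp : 3 ≤ p) (hq : 1 ≤ q) (hqp : q ≤ p - 2)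
    (hpar : ((p - 2) * (p - 1) / 2) % 2 = q % 2) :
    ∃ T, {q} + T = Multiset.range (p - 1) + {0} ∧ IsReducedSpectrum p T := by
  obtain ⟨N, rfl⟩ : ∃ N, p = N + 2 := ⟨p - 2, by omega⟩
  simp only [Nat.add_sub_cancel, show N + 2 - 1 = N + 1 by omega] at *
  rcases hqp.lt_or_eq with hlt | rfl
  · obtain ⟨T, hT, hr⟩ := omitRealizable hq hlt hpar
    refine ⟨_, ?_, hr.add_vertex.add_vertex⟩
    rw [← hT]; abel
  -- The top value is omitted: a disjoint edge fills the gap at 2 in a smaller graph, and an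
  -- isolated vertex gives the third 0.
  · obtain ⟨k, rfl⟩ : ∃ k, q = k + 1 := ⟨q - 1, by omega⟩
    rcases Nat.eq_zero_or_pos k with rfl | hk
    · exact ⟨_, by decide, IsReducedSpectrum.one.add_vertex.add_vertex⟩
    have htri : (k + 1) * (k + 1 + 1) / 2 = k * (k + 1) / 2 + (k + 1) := by
      rw [show (k + 1) * (k + 1 + 1) = k * (k + 1) + (k + 1) * 2 by ring,
        Nat.add_mul_div_right _ _ two_pos]
    have hk2 : 2 < k := by
      by_contra hc
      interval_cases k <;> norm_num at hpar
    obtain ⟨T, hT, hr⟩ := omitRealizable one_le_two hk2 (by omega)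
    refine ⟨_, ?_, (hr.union .two).add_vertex⟩
    rw [range_succ_add (k + 1), ← hT]; abel

theorem add_doubleSet {i j n m : ℕ} (hij : i ≠ j) (hi : i ≤ n) (hj : j ≤ n) (him : i ≠ m)
    (hjm : j ≠ m) : {i} + {j} + doubleSet i j n m = {m} + Multiset.range (n + 1) := by
  ext x
  simp only [doubleSet, Multiset.count_add, Multiset.count_singleton, Multiset.count_filter,
    Multiset.count_cons, Multiset.count_eq_of_nodup (Multiset.nodup_range (n + 1)),
    Multiset.mem_range]
  split_ifs <;> omega

theorem laplacianRealizable_doubleSet {n j : ℕ} (hj : 2 < j) (hjn : j + 2 ≤ n)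
    (hpar : ((n - 4) * (n - 3) / 2) % 2 = (n - 1 - j) % 2) :
    LaplacianRealizable n (doubleSet 2 j n (n - 1)) := by
  obtain ⟨r, rfl⟩ : ∃ r, n = r + 1 + 1 + 1 := ⟨n - 3, by omega⟩
  obtain ⟨T, hT, hr⟩ := exists_three_components (p := r + 1) (q := r + 2 - j) (by omega) (by omega)
    (by omega) (by
      rwa [show r + 1 - 2 = r + 1 + 1 + 1 - 4 by omega,
        show r + 1 - 1 = r + 1 + 1 + 1 - 3 by omega,
        show r + 2 - j = r + 1 + 1 + 1 - 1 - j by omega])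
  -- Three complements separated by two new vertices send an old eigenvalue `t` to `n - 1 - t`. The
  -- two extra zeros become `n - 1` twice, the omitted `q` becomes the gap at `j`, and the new
  -- vertices yield 1 and `n`.
  refine cast (congrArg _ ?_) hr.compl.add_vertex.compl.laplacianRealizable_compl
  have hadd := add_doubleSet (i := 2) (j := j) (n := r + 3) (m := r + 2) (by omega)
    (by omega) (by omega) (by omega) (by omega)
  refine add_left_cancel (Eq.trans ?_ hadd.symm)
  have h1 := congrArg (Multiset.map fun t => r + 3 - (r + 2 - (r + 1 - t))) hT
  have h2 := map_sub_range (r + 2)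
  have h3 : (Multiset.range r).map (fun t => r + 3 - (r + 2 - (r + 1 - t))) =
      (Multiset.range r).map (r + 2 - ·) :=
    Multiset.map_congr rfl fun t ht => by have := Multiset.mem_range.1 ht; omega
  rw [range_succ_add (r + 2), range_succ_add (r + 1), range_succ_add r] at h2
  rw [Nat.add_sub_cancel, Multiset.map_add, Multiset.map_add, h3] at h1
  simp only [Multiset.map_add, Multiset.map_singleton, Nat.sub_zero, Nat.sub_self, Nat.add_assoc,
    Nat.reduceAdd, Nat.add_sub_add_left, Nat.reduceSub, Nat.add_sub_cancel_left, Multiset.map_map,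
    Function.comp_def, show r + 3 - (r + 2 - (r + 1 - (r + 2 - j))) = j by omega] at h1 h2 ⊢
  rw [range_succ_add (r + 3), range_succ_add (r + 2), range_succ_add (r + 1), range_succ_add r,
    ← h2]
  trans ({j} + T.map fun t => r + 3 - (r + 2 - (r + 1 - t))) + {0} + {1} + {2} + {r + 3}
  · abel
  · rw [h1, show r + 3 - 1 = r + 2 from rfl]; abel

/-! ### Parity, cardinality and the final criterion. -/

theorem even_sum_of_laplacianRealizable {n : ℕ} {S : Multiset ℕ} (h : LaplacianRealizable n S) :
    Even S.sum := by
  obtain ⟨-, -, -, G, _, -, hG⟩ := h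
  have ht := Matrix.trace_eq_sum_roots_charpoly_of_splits (G.isHermitian_lapMatrix ℝ).splits_charpoly
  rw [← laplacianSpectrum, hG, ← Nat.coe_castAddMonoidHom, ← AddMonoidHom.map_multiset_sum] at ht
  have hdeg : (G.lapMatrix ℝ).trace = ((∑ v, G.degree v : ℕ) : ℝ) := by
    simp [Matrix.trace, lapMatrix_apply]
  rw [hdeg, Nat.coe_castAddMonoidHom, Nat.cast_inj, G.sum_degrees_eq_twice_card_edges] at ht
  exact ⟨_, (ht.symm.trans (two_mul _))⟩

theorem triangle_mod_two (n : ℕ) :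
    (n * (n + 1) / 2) % 2 = if n % 4 = 0 ∨ n % 4 = 3 then 0 else 1 := by
  have h : n * (n + 1) % 4 = (n % 4) * (n % 4 + 1) % 4 := by simp [Nat.mul_mod, Nat.add_mod]
  have h4 : n % 4 < 4 := Nat.mod_lt _ (by norm_num)
  generalize n * (n + 1) = a at *
  generalize n % 4 = r at *
  interval_cases r <;> simp at h ⊢ <;> omega

theorem laplacianRealizable_doubleSet_iff {n j : ℕ} (hn : 3 ≤ n) (hj : 2 < j) (hjn : j ≤ n)
    (hpar : j = n → n % 4 = 0 ∨ n % 4 = 3) :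
    LaplacianRealizable n (doubleSet 2 j n (n - 1)) ↔
      j + 2 ≤ n ∧ (n * (n + 1) / 2 + n + 1) % 2 = j % 2 := by
  have htri := triangle_mod_two n
  constructor
  · intro h
    -- Removing both copies of `n - 1` would leave only `n - 1` elements.
    have hj1 : j ≠ n - 1 := by
      rintro rfl
      have hcard := h.2.1
      have h2 : {2} + {n - 1} + {n - 1} + doubleSet 2 (n - 1) n (n - 1) =
          {n - 1} + Multiset.range (n + 1) := by
        ext x
        simp only [doubleSet, Multiset.count_add, Multiset.count_singleton, Multiset.count_filter,
          Multiset.count_cons, Multiset.count_eq_of_nodup (Multiset.nodup_range (n + 1)),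
          Multiset.mem_range]
        split_ifs <;> omega
      have h3 := congrArg Multiset.card h2
      simp only [Multiset.card_add, Multiset.card_singleton, Multiset.card_range, hcard] at h3
      omega
    have hn2 : 2 ≠ n - 1 := by
      rintro h2
      obtain rfl : n = 3 := by omega
      obtain rfl : j = 3 := by omega
      exact absurd h.2.1 (by decide)
    have hsum := congrArg Multiset.sum
      (add_doubleSet (i := 2) (j := j) (n := n) (m := n - 1) (by omega) (by omega) hjn hn2 hj1)
    have hrange : (Multiset.range (n + 1)).sum = n * (n + 1) / 2 := by
      have := Finset.sum_range_id (n + 1)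
      rw [Nat.add_sub_cancel, mul_comm] at this
      rw [← this]
      exact congrArg _ (Multiset.map_id _).symm
    simp only [Multiset.sum_add, Multiset.sum_singleton, hrange] at hsum
    have heven := Nat.even_iff.1 (even_sum_of_laplacianRealizable h)
    have hlt : j ≠ n := fun hjn => by
      rw [if_pos (hpar hjn)] at htri
      omega
    omega
  · rintro ⟨h1, h2⟩
    refine laplacianRealizable_doubleSet hj h1 ?_
    -- The parity of triangular numbers has period 4.
    have htri' := triangle_mod_two (n - 4)
    rw [show (n - 4) % 4 = n % 4 by omega, show n - 4 + 1 = n - 3 by omega, ← htri] at htri'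
    omega

theorem mainTheorem5 (n : ℕ) (hn : 3 ≤ n) :
    (n % 4 = 0 → ∀ j : ℕ, 2 < j → j ≤ n →
      (LaplacianRealizable n (doubleSet 2 j n (n - 1)) ↔
        ∃ k : ℕ, 1 ≤ k ∧ (k : ℚ) ≤ ((n : ℚ) - 4) / 2 ∧ j = 2 * k + 1)) ∧
    (n % 4 = 1 → ∀ j : ℕ, 2 < j → j < n →
      (LaplacianRealizable n (doubleSet 2 j n (n - 1)) ↔
        ∃ k : ℕ, 1 ≤ k ∧ (k : ℚ) ≤ ((n : ℚ) - 3) / 2 ∧ j = 2 * k + 1)) ∧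
    (n % 4 = 2 → ∀ j : ℕ, 2 < j → j < n →
      (LaplacianRealizable n (doubleSet 2 j n (n - 1)) ↔
        ∃ k : ℕ, 1 ≤ k ∧ (k : ℚ) ≤ ((n : ℚ) - 4) / 2 ∧ j = 2 * k + 2)) ∧
    (n % 4 = 3 → ∀ j : ℕ, 2 < j → j ≤ n →
      (LaplacianRealizable n (doubleSet 2 j n (n - 1)) ↔
        ∃ k : ℕ, 1 ≤ k ∧ (k : ℚ) ≤ ((n : ℚ) - 5) / 2 ∧ j = 2 * k + 2)) := by
  have hrat : ∀ k c : ℕ, (k : ℚ) ≤ ((n : ℚ) - c) / 2 ↔ 2 * k + c ≤ n := fun k c => by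
    rw [le_div_iff₀ two_pos, le_sub_iff_add_le, mul_comm]
    exact_mod_cast Iff.rfl
  have hrat4 : ∀ k : ℕ, (k : ℚ) ≤ ((n : ℚ) - 4) / 2 ↔ 2 * k + 4 ≤ n := fun k => hrat k 4
  have hrat3 : ∀ k : ℕ, (k : ℚ) ≤ ((n : ℚ) - 3) / 2 ↔ 2 * k + 3 ≤ n := fun k => hrat k 3
  have hrat5 : ∀ k : ℕ, (k : ℚ) ≤ ((n : ℚ) - 5) / 2 ↔ 2 * k + 5 ≤ n := fun k => hrat k 5
  have htri := triangle_mod_two n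
  refine ⟨fun h j hj hjn => ?_, fun h j hj hjn => ?_, fun h j hj hjn => ?_, fun h j hj hjn => ?_⟩
  all_goals
    rw [laplacianRealizable_doubleSet_iff hn hj (by omega) (by omega)]
    simp only [hrat3, hrat4, hrat5]
    constructor
    · intro hk
      refine ⟨(j - 1) / 2, ?_⟩
      split_ifs at htri <;> omega
    · rintro ⟨k, hk⟩
      split_ifs at htri <;> omega
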